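/- **Setting.** Let $K_1\ge K_2>L\ge 1$ and $N\ge 1$ be integers. In the $(K_1,K_2,L,M,N)$ two-dimensional multi-access coded caching problem a server holds $N$ files of equal size and is connected by an error-free broadcast link to $K_1K_2$ cache-less users placed on a $K_1\times K_2$ grid, with one cache-node of memory $M$ files ($0\le M\le N/L^2$) at each grid position. The user at $(k_1,k_2)$ can read the content of the cache-node at $(k_1',k_2')$ exactly when $(k_1-k_1')\bmod K_1<L$ and $(k_2-k_2')\bmod K_2<L$. Each file is divided into $F$ packets of equal, sufficiently large length; each cache-node stores at most $MF$ packets computed from the files (before the demands are known); then every user demands one file and, for the demand vector $\mathbf d$, the server broadcasts $S_{\mathbf d}$ packets from which, together with its accessible caches, every user recovers its file. The load is $R=\max_{\mathbf d}S_{\mathbf d}/F$. **Hybrid scheme.** Let $t\in\{1,\dots,\lfloor K_1/L\rfloor\}$ and $K_1'=K_1-t(L-1)$; all indices start from $0$. The rows of the arrays are the pairs $(T,f)$ with $T=\{T_0<\dots<T_{t-1}\}\subseteq\{0,\dots,K_1'-1\}$ and $f=(f_0,\dots,f_{t-1})\in\{0,\dots,K_2-1\}^t$; the columns are the grid positions.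 Each file is divided into $F=K_1\binom{K_1'}{t}K_2^t$ packets, one for each pair of a round $r\in\{0,\dots,K_1-1\}$ and a row. The node-placement array has a star in row $(T,f)$ exactly in the columns $(T_i+i(L-1),\,f_i)$, $0\le i<t$. The user-delivery array has the following non-star entries. - *Type I* (inner Partition PDA): in column $(T_i+i(L-1)+l,\;k_2)$ with $0\le l<L$ and $(k_2-f_i)\bmod K_2\ge L$, the symbol $(T,l,f',(f_i-k_2)\bmod K_2)$, where $f'$ is $f$ with its $i$-th coordinate replaced by $k_2$. - *Type II* (outer MN PDA): for $k\in\{0,\dots,K_1'-1\}\setminus T$ and $h=|\{x\in T:x<k\}|$, in column $(k+h(L-1),\;k_2)$, the symbol $(T\cup\{k\},e)$, where $e$ is obtained from $f$ by inserting $k_2$ at position $h$. In round $r$ both arrays are shifted cyclically by $r$ in the first grid coordinate. Each cache-node stores, for every file, the packets whose row has a star in its column; for each round and each symbol occurring in the user-delivery array, the server broadcasts the XOR of the packets demanded at the entries that carry this symbol. **Theorem 4 (Hybrid Scheme via MN PDA).** For every $t\in\{1,\dots,\lfloor K_1/L\rfloor\}$ the hybrid scheme satisfies all demands, with memory and load $$(M,R)=\left(\frac{Nt}{K_1K_2},\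 \frac{K_2tL-tL^2}{t}+\frac{K_1K_2-K_2tL}{t+1}\right).$$ These points, and also $(M,R)=(0,K_1K_2)$ and $(M,R)=\left(\frac N{L^2},0\right)$, are achievable, and so is their lower convex envelope on $0\le M\le N/L^2$: its load is attained by a scheme with finite $F$ at every rational $M$, and up to an arbitrarily small excess at every real $M$. -/

import Mathlib

/-- Positions in the `K₁ × K₂` grid; at each position there is one cache-node and one user. -/
abbrev Grid (K₁ K₂ : ℕ) : Type := Fin K₁ × Fin K₂

/-- The user at position `u` can access the cache-node at position `c`: both cyclic distances
`(u₁ - c₁) mod K₁` and `(u₂ - c₂) mod K₂` are less than `L` (subtraction in `Fin` is modular). -/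
def Accesses {K₁ K₂ : ℕ} (L : ℕ) (u c : Grid K₁ K₂) : Prop :=
  (u.1 - c.1).val < L ∧ (u.2 - c.2).val < L

/-- A packet of `b` bits; addition is the bitwise XOR. -/
abbrev Packet (b : ℕ) : Type := Fin b → ZMod 2

/-- The placement and delivery rules of a caching scheme for `N` files on the `K₁ × K₂` grid,
packets being elements of `A`. Each file is divided into packets indexed by `Pkt`.
Cache-node `c` stores one packet, computed from the library, for each index in `Cch c`;
under the demand `d` the server broadcasts one packet for each index in `Msg d`. -/
structure Protocol (K₁ K₂ N : ℕ) (A : Type) where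
  Pkt : Type
  Cch : Grid K₁ K₂ → Type
  Msg : (Grid K₁ K₂ → Fin N) → Type
  finite_pkt : Finite Pkt
  finite_cch : ∀ c, Finite (Cch c)
  finite_msg : ∀ d, Finite (Msg d)
  place : (Fin N → Pkt → A) → ∀ c, Cch c → A
  send : ∀ d : Grid K₁ K₂ → Fin N, (Fin N → Pkt → A) → Msg d → A

namespace Protocol

variable {K₁ K₂ N : ℕ} {A : Type}

/-- The subpacketization: number of packets per file. -/
noncomputable def F (P : Protocol K₁ K₂ N A) : ℕ := Nat.card P.Pkt

/-- The number of packets stored in the cache-node `c`. -/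
noncomputable def cacheSize (P : Protocol K₁ K₂ N A) (c : Grid K₁ K₂) : ℕ := Nat.card (P.Cch c)

/-- The number of packets broadcast under the demand `d`. -/
noncomputable def numSent (P : Protocol K₁ K₂ N A) (d : Grid K₁ K₂ → Fin N) : ℕ :=
  Nat.card (P.Msg d)

/-- For every demand, each user recovers its requested file from the contents of its accessible
cache-nodes and the broadcast packets. -/
def Decodable (P : Protocol K₁ K₂ N A) (L : ℕ) : Prop :=
  ∀ (d : Grid K₁ K₂ → Fin N) (u : Grid K₁ K₂),
    ∃ dec : ((c : {c : Grid K₁ K₂ // Accesses L u c}) → P.Cch c.1 → A) →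
        (P.Msg d → A) → (P.Pkt → A),
      ∀ W : Fin N → P.Pkt → A, dec (fun c => P.place W c.1) (P.send d W) = W (d u)

end Protocol

/-- The memory-load pair `(M, R)` is exactly achieved in the `(K₁, K₂, L, M, N)` problem: for some
subpacketization `F` and all sufficiently long packets, there is a decodable scheme storing at most
`M F` packets in each cache-node and broadcasting at most `R F` packets under each demand. -/
def Achieves (K₁ K₂ L N : ℕ) (M R : ℝ) : Prop :=
  ∃ F : ℕ, 0 < F ∧ ∃ b₀ : ℕ, ∀ b : ℕ, b₀ ≤ b →
    ∃ P : Protocol K₁ K₂ N (Packet b), P.F = F ∧ P.Decodable L ∧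
      (∀ c, (P.cacheSize c : ℝ) ≤ M * F) ∧ (∀ d, (P.numSent d : ℝ) ≤ R * F)

/-- The lower convex envelope, at abscissa `x`, of a set of points in the plane. -/
noncomputable def lowerConvexEnvelope (S : Set (ℝ × ℝ)) (x : ℝ) : ℝ :=
  sInf {y : ℝ | (x, y) ∈ convexHull ℝ S}

/-- The load of the hybrid scheme with parameter `t`. -/
noncomputable def hybridLoad (K₁ K₂ L t : ℕ) : ℝ :=
  ((K₂ : ℝ) * t * L - t * (L : ℝ) ^ 2) / t + ((K₁ : ℝ) * K₂ - K₂ * t * L) / (t + 1)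

/-- The memory-load corner points. -/
def cornerPoints (K₁ K₂ L N : ℕ) : Set (ℝ × ℝ) :=
  {p | ∃ t : ℕ, 1 ≤ t ∧ t ≤ K₁ / L ∧
      p = ((N : ℝ) * t / ((K₁ : ℝ) * K₂), hybridLoad K₁ K₂ L t)} ∪
    {((0 : ℝ), (K₁ : ℝ) * K₂), ((N : ℝ) / (L : ℝ) ^ 2, (0 : ℝ))}

/-! The hybrid scheme. In all arrays, `none` stands for the symbol `*`, and indices
start from `0`. -/

/-- Row indices of the MN PDA with `K` columns: the `t`-subsets of the set of columns. -/
abbrev MNRow (K t : ℕ) : Type := {T : Finset (Fin K) // T.card = t}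

/-- The MN PDA. -/
def mnPDA {K t : ℕ} (T : MNRow K t) (k : Fin K) : Option (Finset (Fin K)) :=
  if k ∈ T.1 then none else some (insert k T.1)

/-- The `i`-th block of the Partition PDA: there is a star in row `f` and column `k` iff `k` is one
of the `z` cyclically consecutive columns `f i, f i + 1, …, f i + (z - 1)`. -/
def partitionPDA {q m : ℕ} (z : ℕ) (i : Fin m) (f : Fin m → Fin q) (k : Fin q) :
    Option ((Fin m → Fin q) × Fin q) :=
  if (k - f i).val < z then none else some (Function.update f i k, f i - k)

/-- The `i`-th (from left to right) vertical position at which the row `T` of the outer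
node-placement array has a star. -/
def outerStar {K t : ℕ} (L : ℕ) (T : MNRow K t) (i : Fin t) : ℕ :=
  (T.1.orderEmbOfFin T.2 i).val + i.val * (L - 1)

/-- The number of elements of `T` smaller than `k`. -/
def rankIn {K t : ℕ} (T : MNRow K t) (k : Fin K) : Fin (t + 1) :=
  ⟨(T.1.filter (· < k)).card,
    Nat.lt_succ_of_le ((Finset.card_filter_le _ _).trans T.2.le)⟩

section Hybrid

variable (K₁ K₂ L t : ℕ)

/-- Row indices of the arrays of one round: a row of the outer MN PDA, which has
`K₁ - t (L - 1)` columns, and a row of the inner Partition PDA. -/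
abbrev HybridRow : Type := MNRow (K₁ - t * (L - 1)) t × (Fin t → Fin K₂)

/-- Symbols of the user-delivery array of one round. A Type I symbol is a symbol of the copy of the
Partition PDA attached to an outer row `T` and an offset `l < L`; a Type II symbol is a pair of
a symbol of the MN PDA and a vector in `[K₂] ^ (t + 1)`. -/
abbrev HybridSymbol : Type :=
  (MNRow (K₁ - t * (L - 1)) t × Fin L × ((Fin t → Fin K₂) × Fin K₂)) ⊕
    (Finset (Fin (K₁ - t * (L - 1))) × (Fin (t + 1) → Fin K₂))

variable {K₁ K₂ L t}

/-- The node-placement array of the first round has a star in row `(T, f)` and column `c`: the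
`i`-th star of the outer row `T` is replaced by the array having its only star of row `f`
in column `f i`. -/
def HybridStar (j : HybridRow K₁ K₂ L t) (c : Grid K₁ K₂) : Prop :=
  ∃ i : Fin t, c.1.val = outerStar L j.1 i ∧ c.2 = j.2 i

/-- `HybridEntry j u s`: the entry of the user-delivery array of the first round in row `j` and
column `u` is the (non-star) symbol `s`.
* Type I: each of the `L` stars of the `i`-th group of the outer user-retrieve array is replaced by
  a copy of the `i`-th block of the Partition PDA.
* Type II: the vertical positions outside all groups are in increasing bijection with the columns
  `k ∉ T` of the MN PDA; the position corresponding to `k` is `k + h (L - 1)` with `h` the number of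
  elements of `T` below `k`. -/
inductive HybridEntry : HybridRow K₁ K₂ L t → Grid K₁ K₂ → HybridSymbol K₁ K₂ L t → Prop
  | typeI (j : HybridRow K₁ K₂ L t) (u : Grid K₁ K₂) (i : Fin t) (l : Fin L)
      (v : (Fin t → Fin K₂) × Fin K₂)
      (hu : u.1.val = outerStar L j.1 i + l.val)
      (hv : partitionPDA L i j.2 u.2 = some v) :
      HybridEntry j u (Sum.inl (j.1, l, v))
  | typeII (j : HybridRow K₁ K₂ L t) (u : Grid K₁ K₂) (k : Fin (K₁ - t * (L - 1)))
      (s : Finset (Fin (K₁ - t * (L - 1))))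
      (hu : u.1.val = k.val + (rankIn j.1 k).val * (L - 1))
      (hs : mnPDA j.1 k = some s) :
      HybridEntry j u (Sum.inr (s, Fin.insertNth (α := fun _ => Fin K₂) (rankIn j.1 k) u.2 j.2))

/-- The column of the first-round arrays which is moved to column `c` in round `r`. -/
def unshift (r : Fin K₁) (c : Grid K₁ K₂) : Grid K₁ K₂ := (c.1 - r, c.2)

variable (K₁ K₂ L t)

open Classical in
/-- The hybrid scheme with the MN PDA as the outer structure. Packets are indexed by a round
and a row. A cache-node stores, for all files, the packets whose row has a star in its column.
For each round and each symbol occurring in the user-delivery array, the server broadcasts the sum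
of the requested packets over all entries carrying this symbol. -/
noncomputable def hybridProtocol (N : ℕ) (A : Type) [AddCommMonoid A] : Protocol K₁ K₂ N A where
  Pkt := Fin K₁ × HybridRow K₁ K₂ L t
  Cch c := Fin N × {p : Fin K₁ × HybridRow K₁ K₂ L t // HybridStar p.2 (unshift p.1 c)}
  Msg _ := Fin K₁ × {s : HybridSymbol K₁ K₂ L t // ∃ j u, HybridEntry j u s}
  finite_pkt := inferInstance
  finite_cch _ := inferInstance
  finite_msg _ := inferInstance
  place W _ x := W x.1 x.2.1
  send d W m :=
    ∑ e : HybridRow K₁ K₂ L t × Grid K₁ K₂ with HybridEntry e.1 (unshift m.1 e.2) m.2.1,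
      W (d e.2) (m.1, e.1)

end Hybrid

/-! ### Caching protocols -/

namespace Protocol

variable {K₁ K₂ N : ℕ} {A : Type}

/-! The hybrid scheme works because its arrays have the placement delivery property: if two distinct
entries $(j,u)$ and $(j',u')$ carry the same symbol, then user $u$ can access a cache-node storing
the packet of row $j'$ (`HybridEntry.eq_or_star`). So in each broadcast sum a user knows every term
except the one it wants. As every entry without a symbol belongs to an accessible packet
(`hybridEntry_or_star`), all demands are met (`hybridProtocol_decodable`). Memory and load are
counts. A row $T$ and an index $i$ determine the one round in which star $i$ meets a given vertical
position (`storedEquiv`). The occurring symbols are listed by `symbolEquiv`, and the ratio of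
$\binom{K_1'}{t+1}$ to $\binom{K_1'}{t}$ is $(K_1'-t)/(t+1)$ with $K_1'-t=K_1-tL$. The two extreme
points come from uncoded unicast and from an MDS-coded placement. Memory sharing with rational
weights (`Achieves.convexComb`) fills in chords, and `lowerConvexEnvelope_eq_segment` shows that the
envelope of a finite set is always attained at a point or on a chord. -/

/-- A map that is constant on the fibres of the user's observation factors through it, so no decoder
has to be written down. Nonemptiness supplies its values at impossible observations. -/
theorem decodable_of_determined [Nonempty A] {P : Protocol K₁ K₂ N A} {L : ℕ}
    (h : ∀ (d : Grid K₁ K₂ → Fin N) (u : Grid K₁ K₂) (W W' : Fin N → P.Pkt → A),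
      (∀ c, Accesses L u c → P.place W c = P.place W' c) → P.send d W = P.send d W' →
        W (d u) = W' (d u)) : P.Decodable L := by
  intro d u
  let obs : (Fin N → P.Pkt → A) →
      ((c : {c : Grid K₁ K₂ // Accesses L u c}) → P.Cch c.1 → A) × (P.Msg d → A) :=
    fun W => (fun c => P.place W c.1, P.send d W)
  have hf : Function.FactorsThrough (fun W : Fin N → P.Pkt → A => W (d u)) obs := by
    intro W W' hW
    refine h d u W W' (fun c hc => ?_) (congrArg Prod.snd hW)
    exact congrFun (congrArg Prod.fst hW) ⟨c, hc⟩
  obtain ⟨e, he⟩ := (Function.factorsThrough_iff _).1 hf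
  exact ⟨fun x y => e (x, y), fun W => (congrFun he W).symm⟩

theorem Decodable.determined {P : Protocol K₁ K₂ N A} {L : ℕ} (hP : P.Decodable L)
    {d : Grid K₁ K₂ → Fin N} {u : Grid K₁ K₂} {W W' : Fin N → P.Pkt → A}
    (hc : ∀ c, Accesses L u c → P.place W c = P.place W' c) (hs : P.send d W = P.send d W') :
    W (d u) = W' (d u) := by
  obtain ⟨dec, hdec⟩ := hP d u
  rw [← hdec W, ← hdec W', hs]
  congr 1
  funext c
  exact hc c.1 c.2

/-- Memory sharing: each file is cut into `m` parts treated by `P` and `n` parts treated by `Q`. -/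
def share (m n : ℕ) (P Q : Protocol K₁ K₂ N A) : Protocol K₁ K₂ N A where
  Pkt := Fin m × P.Pkt ⊕ Fin n × Q.Pkt
  Cch c := Fin m × P.Cch c ⊕ Fin n × Q.Cch c
  Msg d := Fin m × P.Msg d ⊕ Fin n × Q.Msg d
  finite_pkt := by
    have := P.finite_pkt
    have := Q.finite_pkt
    infer_instance
  finite_cch c := by
    have := P.finite_cch c
    have := Q.finite_cch c
    infer_instance
  finite_msg d := by
    have := P.finite_msg d
    have := Q.finite_msg d
    infer_instance
  place W c := Sum.elim (fun x => P.place (fun n p => W n (Sum.inl (x.1, p))) c x.2)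
    (fun x => Q.place (fun n p => W n (Sum.inr (x.1, p))) c x.2)
  send d W := Sum.elim (fun x => P.send d (fun n p => W n (Sum.inl (x.1, p))) x.2)
    (fun x => Q.send d (fun n p => W n (Sum.inr (x.1, p))) x.2)

variable (m n : ℕ) (P Q : Protocol K₁ K₂ N A)

theorem share_F : (share m n P Q).F = m * P.F + n * Q.F := by
  have := P.finite_pkt
  have := Q.finite_pkt
  simp [F, share, Nat.card_sum, Nat.card_prod]

theorem share_cacheSize (c : Grid K₁ K₂) :
    (share m n P Q).cacheSize c = m * P.cacheSize c + n * Q.cacheSize c := by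
  have := P.finite_cch c
  have := Q.finite_cch c
  simp [cacheSize, share, Nat.card_sum, Nat.card_prod]

theorem share_numSent (d : Grid K₁ K₂ → Fin N) :
    (share m n P Q).numSent d = m * P.numSent d + n * Q.numSent d := by
  have := P.finite_msg d
  have := Q.finite_msg d
  simp [numSent, share, Nat.card_sum, Nat.card_prod]

variable {P Q}

theorem Decodable.share [Nonempty A] {L : ℕ} (hP : P.Decodable L) (hQ : Q.Decodable L) :
    (share m n P Q).Decodable L := by
  refine decodable_of_determined fun d u W W' hc hs => ?_
  funext p
  rcases p with ⟨i, p⟩ | ⟨i, p⟩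
  · refine congrFun (hP.determined (d := d) (u := u)
      (W := fun n p => W n (Sum.inl (i, p))) (W' := fun n p => W' n (Sum.inl (i, p)))
      (fun c h => ?_) ?_) p
    · funext x
      exact congrFun (hc c h) (Sum.inl (i, x))
    · funext x
      exact congrFun hs (Sum.inl (i, x))
  · refine congrFun (hQ.determined (d := d) (u := u)
      (W := fun n p => W n (Sum.inr (i, p))) (W' := fun n p => W' n (Sum.inr (i, p)))
      (fun c h => ?_) ?_) p
    · funext x
      exact congrFun (hc c h) (Sum.inr (i, x))
    · funext x
      exact congrFun hs (Sum.inr (i, x))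

/-- Uncoded unicast: nothing is cached and every requested file is sent. -/
def unicast (K₁ K₂ N : ℕ) (A : Type) : Protocol K₁ K₂ N A where
  Pkt := Unit
  Cch _ := Empty
  Msg _ := Grid K₁ K₂
  finite_pkt := inferInstance
  finite_cch _ := inferInstance
  finite_msg _ := inferInstance
  place _ _ := Empty.elim
  send d W u := W (d u) ()

theorem unicast_decodable [Nonempty A] (L : ℕ) : (unicast K₁ K₂ N A).Decodable L :=
  decodable_of_determined fun _ u _ _ _ hs => funext fun _ => congrFun hs u

/-- Every file is encoded with a Reed–Solomon code over a field identified with the set of packets;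
each cache-node stores one coded packet per file and nothing is sent. -/
noncomputable def codedPlacement (K₁ K₂ N s : ℕ) {𝕜 : Type} [Field 𝕜] (φ : A ≃ 𝕜)
    (x : Grid K₁ K₂ → 𝕜) : Protocol K₁ K₂ N A where
  Pkt := Fin s
  Cch _ := Fin N
  Msg _ := Empty
  finite_pkt := inferInstance
  finite_cch _ := inferInstance
  finite_msg _ := inferInstance
  place W c n := φ.symm (∑ j : Fin s, x c ^ (j : ℕ) * φ (W n j))
  send _ _ := Empty.elim

/-- A user reads $L^2$ nodes with distinct evaluation points, and a polynomial with $L^2$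
coefficients is determined by its values there (Vandermonde). -/
theorem codedPlacement_decodable {L : ℕ} (h₁ : L ≤ K₁) (h₂ : L ≤ K₂)
    {𝕜 : Type} [Field 𝕜] (φ : A ≃ 𝕜) {x : Grid K₁ K₂ → 𝕜} (hx : Function.Injective x) :
    (codedPlacement K₁ K₂ N (L * L) φ x).Decodable L := by
  have : Nonempty A := ⟨φ.symm 0⟩
  refine decodable_of_determined fun d u W W' hc _ => ?_
  have : NeZero K₁ := ⟨u.1.pos.ne'⟩
  have : NeZero K₂ := ⟨u.2.pos.ne'⟩
  -- The $L\times L$ window of nodes behind $u$; $L\le K_1$ and $L\le K_2$ keep its points distinct.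
  let g : Fin (L * L) → Grid K₁ K₂ := fun j =>
    (u.1 - Fin.castLE h₁ (finProdFinEquiv.symm j).1, u.2 - Fin.castLE h₂ (finProdFinEquiv.symm j).2)
  have hg : Function.Injective g := by
    intro a b hab
    have h1 := sub_right_injective (congrArg Prod.fst hab)
    have h2 := sub_right_injective (congrArg Prod.snd hab)
    exact finProdFinEquiv.symm.injective
      (Prod.ext (Fin.castLE_injective _ h1) (Fin.castLE_injective _ h2))
  have hacc : ∀ j, Accesses L u (g j) := by
    intro j
    simp only [Accesses, g, sub_sub_cancel, Fin.val_castLE]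
    exact ⟨Fin.is_lt _, Fin.is_lt _⟩
  have key : (fun j => φ (W (d u) j) - φ (W' (d u) j)) = 0 := by
    refine Matrix.eq_zero_of_forall_index_sum_pow_mul_eq_zero (hx.comp hg) fun j => ?_
    have h := φ.symm.injective (congrFun (hc (g j) (hacc j)) (d u))
    simp only [mul_sub, Finset.sum_sub_distrib, Function.comp]
    exact sub_eq_zero.2 h
  funext j
  exact φ.injective (sub_eq_zero.1 (congrFun key j))

end Protocol

/-! ### Achievable pairs -/

section Achieves

variable {K₁ K₂ L N : ℕ}

theorem Achieves.mono {M M' R R' : ℝ} (h : Achieves K₁ K₂ L N M R) (hM : M ≤ M') (hR : R ≤ R') :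
    Achieves K₁ K₂ L N M' R' := by
  obtain ⟨F, hF, b₀, h⟩ := h
  refine ⟨F, hF, b₀, fun b hb => ?_⟩
  obtain ⟨P, hPF, hd, hc, hs⟩ := h b hb
  exact ⟨P, hPF, hd, fun c => (hc c).trans (by gcongr), fun d => (hs d).trans (by gcongr)⟩

/-- Memory sharing cuts a file into whole numbers of packets, hence the rational weight. -/
theorem Achieves.convexComb {M M' R R' : ℝ} (h : Achieves K₁ K₂ L N M R)
    (h' : Achieves K₁ K₂ L N M' R') {w : ℚ} (h0 : 0 ≤ w) (h1 : w ≤ 1) :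
    Achieves K₁ K₂ L N (w * M + (1 - w) * M') (w * R + (1 - w) * R') := by
  obtain ⟨F, hF, b, h⟩ := h
  obtain ⟨F', hF', b', h'⟩ := h'
  obtain ⟨m, n, hmn, hw⟩ : ∃ m n : ℕ, 0 < m + n ∧ (w : ℝ) = m / (m + n : ℕ) := by
    have hnum : 0 ≤ w.num := Rat.num_nonneg.2 h0
    have hle : w.num ≤ w.den := Rat.num_le_denom_iff.2 h1
    refine ⟨w.num.toNat, w.den - w.num.toNat, by have := w.den_pos; omega, ?_⟩
    rw [Nat.add_sub_cancel' (by omega), Rat.cast_def]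
    congr 1
    exact_mod_cast (Int.toNat_of_nonneg hnum).symm
  have hpos : (0 : ℝ) < (m + n : ℕ) := by exact_mod_cast hmn
  have hw' : 1 - (w : ℝ) = n / (m + n : ℕ) := by
    rw [hw]
    field_simp
    push_cast
    ring
  -- With $mF'$ copies of the first scheme and $nF$ of the second, the packet counts $mF'F$ and
  -- $nFF'$ are in the ratio $m:n$.
  refine ⟨(m + n) * (F * F'), by positivity, max b b', fun c hc => ?_⟩
  obtain ⟨P, hPF, hPd, hPc, hPs⟩ := h c ((le_max_left _ _).trans hc)
  obtain ⟨Q, hQF, hQd, hQc, hQs⟩ := h' c ((le_max_right _ _).trans hc)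
  have key : ∀ (p q : ℕ) (X Y : ℝ), (p : ℝ) ≤ X * F → (q : ℝ) ≤ Y * F' →
      (((m * F') * p + (n * F) * q : ℕ) : ℝ) ≤
        (w * X + (1 - w) * Y) * (((m + n) * (F * F') : ℕ) : ℝ) := by
    intro p q X Y hp hq
    rw [hw', hw]
    calc (((m * F') * p + (n * F) * q : ℕ) : ℝ)
        = m * F' * p + n * F * q := by push_cast; ring
      _ ≤ m * F' * (X * F) + n * F * (Y * F') := by gcongr
      _ = _ := by
        push_cast
        push_cast at hpos
        field_simp
  refine ⟨Protocol.share (m * F') (n * F) P Q, ?_, hPd.share _ _ hQd, fun c => ?_, fun d => ?_⟩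
  · rw [Protocol.share_F, hPF, hQF]
    ring
  · rw [Protocol.share_cacheSize]
    exact key _ _ _ _ (hPc c) (hQc c)
  · rw [Protocol.share_numSent]
    exact key _ _ _ _ (hPs d) (hQs d)

theorem achieves_zero_memory : Achieves K₁ K₂ L N 0 ((K₁ : ℝ) * K₂) := by
  refine ⟨1, one_pos, 0, fun b _ => ⟨Protocol.unicast K₁ K₂ N _, ?_,
    Protocol.unicast_decodable L, fun c => ?_, fun d => ?_⟩⟩
  · simp [Protocol.F, Protocol.unicast]
  · simp [Protocol.cacheSize, Protocol.unicast]
  · simp [Protocol.numSent, Protocol.unicast]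

theorem achieves_zero_load (hL : 0 < L) (h₁ : L ≤ K₁) (h₂ : L ≤ K₂) :
    Achieves K₁ K₂ L N ((N : ℝ) / (L : ℝ) ^ 2) 0 := by
  -- This bound gives $b\ne 0$, so that the field has $2^b$ elements, and $2^b\ge K_1K_2$, enough
  -- for distinct evaluation points.
  refine ⟨L * L, Nat.mul_pos hL hL, K₁ * K₂ + 1, fun b hb => ?_⟩
  have : Fact (Nat.Prime 2) := ⟨Nat.prime_two⟩
  have hcard : Nat.card (GaloisField 2 b) = 2 ^ b := GaloisField.card 2 b (by omega)
  have : Finite (GaloisField 2 b) := Nat.finite_of_card_ne_zero (by rw [hcard]; positivity)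
  have : Fintype (GaloisField 2 b) := Fintype.ofFinite _
  obtain ⟨φ⟩ : Nonempty (Packet b ≃ GaloisField 2 b) := by
    rw [← Fintype.card_eq, ← Nat.card_eq_fintype_card (α := GaloisField 2 b), hcard]
    simp [ZMod.card]
  obtain ⟨x⟩ : Nonempty (Grid K₁ K₂ ↪ GaloisField 2 b) := by
    apply Function.Embedding.nonempty_of_card_le
    rw [← Nat.card_eq_fintype_card (α := GaloisField 2 b), hcard]
    have := Nat.lt_two_pow_self (n := b)
    simp only [Fintype.card_prod, Fintype.card_fin]
    omega
  refine ⟨Protocol.codedPlacement K₁ K₂ N (L * L) φ x, ?_,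
    Protocol.codedPlacement_decodable h₁ h₂ φ x.injective, fun c => ?_, fun d => ?_⟩
  · simp [Protocol.F, Protocol.codedPlacement]
  · have : (0 : ℝ) < L := by exact_mod_cast hL
    simp only [Protocol.cacheSize, Protocol.codedPlacement, Nat.card_eq_fintype_card,
      Fintype.card_fin]
    push_cast
    field_simp
    exact le_rfl
  · simp [Protocol.numSent, Protocol.codedPlacement]

end Achieves

/-! ### Lower convex envelopes of finite sets -/

theorem Set.Finite.exists_between_of_forall_le {s t : Set ℝ} (hs : s.Finite) (ht : t.Finite)
    (h : ∀ a ∈ s, ∀ b ∈ t, a ≤ b) : ∃ m, (∀ a ∈ s, a ≤ m) ∧ ∀ b ∈ t, m ≤ b := by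
  rcases s.eq_empty_or_nonempty with rfl | hs'
  · obtain ⟨m, hm⟩ := ht.bddBelow
    exact ⟨m, by simp, fun b hb => hm hb⟩
  rcases t.eq_empty_or_nonempty with rfl | ht'
  · obtain ⟨m, hm⟩ := hs.bddAbove
    exact ⟨m, fun b hb => hm hb, by simp⟩
  obtain ⟨m, hm, hm'⟩ := _root_.exists_between_of_forall_le hs' ht' h
  exact ⟨m, fun a ha => hm ha, fun b hb => hm' hb⟩

/-- Among the finitely many heights at $x$ of points and of chords straddling $x$, let $y$ be the
least. A line through $(x,y)$ supports $S$ from below, hence also its convex hull, so $y$ is the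
envelope. -/
theorem lowerConvexEnvelope_eq_segment {S : Set (ℝ × ℝ)} (hS : S.Finite) {x : ℝ}
    (hl : ∃ p ∈ S, p.1 ≤ x) (hr : ∃ q ∈ S, x ≤ q.1) :
    (∃ r ∈ S, r.1 = x ∧ lowerConvexEnvelope S x = r.2) ∨
      ∃ p ∈ S, ∃ q ∈ S, p.1 < x ∧ x < q.1 ∧ lowerConvexEnvelope S x =
        (q.1 - x) / (q.1 - p.1) * p.2 + (1 - (q.1 - x) / (q.1 - p.1)) * q.2 := by
  let chord : (ℝ × ℝ) × (ℝ × ℝ) → ℝ := fun pq =>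
    (pq.2.1 - x) / (pq.2.1 - pq.1.1) * pq.1.2 + (1 - (pq.2.1 - x) / (pq.2.1 - pq.1.1)) * pq.2.2
  let Y : Set ℝ := (fun r : ℝ × ℝ => r.2) '' {r | r ∈ S ∧ r.1 = x} ∪
    chord '' {pq | pq ∈ S ×ˢ S ∧ pq.1.1 < x ∧ x < pq.2.1}
  have hY : Y.Finite := ((hS.subset fun r hr => hr.1).image _).union
    (((hS.prod hS).subset fun r hr => hr.1).image _)
  have hne : Y.Nonempty := by
    obtain ⟨p, hp, hpx⟩ := hl
    obtain ⟨q, hq, hqx⟩ := hr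
    rcases hpx.eq_or_lt with h | hpx
    · exact ⟨_, Or.inl ⟨p, ⟨hp, h⟩, rfl⟩⟩
    rcases hqx.eq_or_lt with h | hqx
    · exact ⟨_, Or.inl ⟨q, ⟨hq, h.symm⟩, rfl⟩⟩
    exact ⟨_, Or.inr ⟨(p, q), ⟨⟨hp, hq⟩, hpx, hqx⟩, rfl⟩⟩
  obtain ⟨y, hyY, hy⟩ := Set.exists_min_image Y id hY hne
  simp only [id] at hy
  -- The slope $m$ of the supporting line separates the slopes from points on the left to $(x,y)$
  -- from those to points on the right. Were a left slope larger than a right one, their chord would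
  -- pass below $y$.
  obtain ⟨m, hm₁, hm₂⟩ := Set.Finite.exists_between_of_forall_le
    (s := (fun r : ℝ × ℝ => (y - r.2) / (x - r.1)) '' {r | r ∈ S ∧ r.1 < x})
    (t := (fun r : ℝ × ℝ => (r.2 - y) / (r.1 - x)) '' {r | r ∈ S ∧ x < r.1})
    ((hS.subset fun r hr => hr.1).image _) ((hS.subset fun r hr => hr.1).image _) (by
      rintro _ ⟨p, ⟨hp, hpx⟩, rfl⟩ _ ⟨q, ⟨hq, hqx⟩, rfl⟩
      have h := hy _ (Or.inr ⟨(p, q), ⟨⟨hp, hq⟩, hpx, hqx⟩, rfl⟩)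
      simp only [chord] at h
      have h1 : 0 < x - p.1 := sub_pos.2 hpx
      have h2 : 0 < q.1 - x := sub_pos.2 hqx
      have h3 : 0 < q.1 - p.1 := by linarith
      have h4 : (q.1 - x) / (q.1 - p.1) * p.2 + (1 - (q.1 - x) / (q.1 - p.1)) * q.2 =
          ((q.1 - x) * p.2 + (x - p.1) * q.2) / (q.1 - p.1) := by
        field_simp
        ring
      rw [h4, le_div_iff₀ h3] at h
      simp only
      rw [div_le_div_iff₀ h1 h2]
      linarith)
  have hline : ∀ r ∈ S, y + m * (r.1 - x) ≤ r.2 := by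
    intro r hr
    rcases lt_trichotomy r.1 x with h | h | h
    · have := hm₁ _ ⟨r, ⟨hr, h⟩, rfl⟩
      simp only at this
      rw [div_le_iff₀ (sub_pos.2 h)] at this
      linarith
    · have := hy _ (Or.inl ⟨r, ⟨hr, h⟩, rfl⟩)
      simp only at this
      rw [h]
      linarith
    · have := hm₂ _ ⟨r, ⟨hr, h⟩, rfl⟩
      simp only at this
      rw [le_div_iff₀ (sub_pos.2 h)] at this
      linarith
  have hull : convexHull ℝ S ⊆ {r : ℝ × ℝ | y + m * (r.1 - x) ≤ r.2} := by
    refine convexHull_min hline ?_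
    intro p hp q hq a b ha hb hab
    simp only [Set.mem_ofPred_eq, Prod.fst_add, Prod.smul_fst, Prod.snd_add, Prod.smul_snd,
      smul_eq_mul] at hp hq ⊢
    obtain rfl : b = 1 - a := by linarith
    nlinarith [mul_le_mul_of_nonneg_left hp ha, mul_le_mul_of_nonneg_left hq hb]
  have henv : (x, y) ∈ convexHull ℝ S → lowerConvexEnvelope S x = y := by
    intro hmem
    refine IsLeast.csInf_eq ⟨hmem, fun z hz => ?_⟩
    simpa using hull hz
  rcases hyY with ⟨r, ⟨hr, hrx⟩, hry⟩ | ⟨⟨p, q⟩, ⟨⟨hp, hq⟩, hpx, hqx⟩, hpq⟩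
  · refine Or.inl ⟨r, hr, hrx, (henv ?_).trans hry.symm⟩
    rw [← hrx, ← hry]
    exact subset_convexHull ℝ S hr
  · refine Or.inr ⟨p, hp, q, hq, hpx, hqx, (henv ?_).trans hpq.symm⟩
    simp only at hpx hqx
    have h3 : 0 < q.1 - p.1 := by linarith
    have hw0 : 0 ≤ (q.1 - x) / (q.1 - p.1) := div_nonneg (by linarith) h3.le
    have hw1 : 0 ≤ 1 - (q.1 - x) / (q.1 - p.1) := by
      rw [sub_nonneg, div_le_one h3]
      linarith
    have := (convex_convexHull ℝ S) (subset_convexHull ℝ S hp) (subset_convexHull ℝ S hq)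
      hw0 hw1 (by ring)
    convert this using 1
    refine Prod.ext ?_ ?_
    · simp only [Prod.fst_add, Prod.smul_fst, smul_eq_mul]
      field_simp
      ring
    · simp only [Prod.snd_add, Prod.smul_snd, smul_eq_mul]
      exact hpq.symm

section Envelope

variable {K₁ K₂ L N : ℕ} {S : Set (ℝ × ℝ)}

/-- Rational abscissas and a rational $M$ make the weight of the chord rational. -/
theorem achieves_lowerConvexEnvelope (hS : S.Finite) (hA : ∀ p ∈ S, Achieves K₁ K₂ L N p.1 p.2)
    (hQ : ∀ p ∈ S, ∃ a : ℚ, (a : ℝ) = p.1) {M : ℚ}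
    (hl : ∃ p ∈ S, p.1 ≤ (M : ℝ)) (hr : ∃ q ∈ S, (M : ℝ) ≤ q.1) :
    Achieves K₁ K₂ L N M (lowerConvexEnvelope S M) := by
  rcases lowerConvexEnvelope_eq_segment hS hl hr with ⟨r, hr, h, he⟩ | ⟨p, hp, q, hq, hpM, hMq, he⟩
  · rw [he, ← h]
    exact hA r hr
  · obtain ⟨a, ha⟩ := hQ p hp
    obtain ⟨b, hb⟩ := hQ q hq
    rw [← ha] at hpM
    rw [← hb] at hMq
    have hpM' : a < M := by exact_mod_cast hpM
    have hMq' : M < b := by exact_mod_cast hMq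
    have hpos : 0 < b - a := by linarith
    have := (hA p hp).convexComb (hA q hq) (w := (b - M) / (b - a))
      (div_nonneg (by linarith) hpos.le) ((div_le_one hpos).2 (by linarith))
    refine this.mono (le_of_eq ?_) (le_of_eq ?_)
    · have : (0 : ℝ) < b - a := by linarith
      push_cast
      rw [← ha, ← hb]
      field_simp
      ring
    · rw [he, ← ha, ← hb]
      push_cast
      rfl

theorem achieves_lowerConvexEnvelope_add (hS : S.Finite)
    (hA : ∀ p ∈ S, Achieves K₁ K₂ L N p.1 p.2) {M ε : ℝ}
    (hl : ∃ p ∈ S, p.1 ≤ M) (hr : ∃ q ∈ S, M ≤ q.1) (hε : 0 < ε) :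
    Achieves K₁ K₂ L N M (lowerConvexEnvelope S M + ε) := by
  rcases lowerConvexEnvelope_eq_segment hS hl hr with ⟨r, hr, h, he⟩ | ⟨p, hp, q, hq, hpM, hMq, he⟩
  · rw [he, ← h]
    exact (hA r hr).mono le_rfl (by linarith)
  · have hpos : 0 < q.1 - p.1 := by linarith
    set v : ℝ := (q.1 - M) / (q.1 - p.1) with hv
    have hv0 : 0 < v := div_pos (by linarith) hpos
    have hv1 : v < 1 := (div_lt_one hpos).2 (by linarith)
    have hvM : M = v * p.1 + (1 - v) * q.1 := by
      rw [hv]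
      field_simp
      ring
    have hD : 0 < |p.2 - q.2| + 1 := by positivity
    -- Rounding the weight up favours the point of smaller memory, so the memory never exceeds $M$;
    -- the load changes by $(w-v)(p_2-q_2)\le\varepsilon$. The $+1$ keeps the denominator positive.
    obtain ⟨w, hvw, hw⟩ := exists_rat_btwn
      (show v < min 1 (v + ε / (|p.2 - q.2| + 1)) from
        lt_min hv1 (lt_add_of_pos_right _ (div_pos hε hD)))
    obtain ⟨hw1, hw2⟩ := lt_min_iff.1 hw
    have hw0 : (0 : ℝ) ≤ w := by linarith
    have := (hA p hp).convexComb (hA q hq) (w := w) (by exact_mod_cast hw0)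
      (by exact_mod_cast hw1.le)
    refine this.mono ?_ ?_
    · rw [hvM]
      nlinarith
    · rw [he]
      have h1 : (w - v) * (|p.2 - q.2| + 1) ≤ ε := by
        rw [← le_div_iff₀ hD]
        linarith
      have h2 : (w - v) * (p.2 - q.2) ≤ (w - v) * (|p.2 - q.2| + 1) := by
        have := le_abs_self (p.2 - q.2)
        exact mul_le_mul_of_nonneg_left (by linarith) (by linarith)
      linarith

end Envelope

/-! ### Positions of the stars -/

section Positions

variable {K t : ℕ}

theorem outerStar_strictMono (L : ℕ) (T : MNRow K t) : StrictMono (outerStar L T) := by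
  intro i i' h
  have h1 : T.1.orderEmbOfFin T.2 i < T.1.orderEmbOfFin T.2 i' :=
    (T.1.orderEmbOfFin T.2).strictMono h
  exact add_lt_add_of_lt_of_le h1 (Nat.mul_le_mul_right _ (le_of_lt h))

/-- From $T_i+1\le K_1'$ and $(i+1)(L-1)\le t(L-1)$. Thus no group of $L$ positions wraps around,
and cyclic distances within it are ordinary differences. -/
theorem outerStar_add_le {K₁ L : ℕ} (T : MNRow (K₁ - t * (L - 1)) t) (i : Fin t) :
    outerStar L T i + L ≤ K₁ := by
  have h := (T.1.orderEmbOfFin T.2 i).isLt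
  have h1 : i.val * (L - 1) + (L - 1) ≤ t * (L - 1) := by
    rw [← Nat.succ_mul]
    exact Nat.mul_le_mul_right _ i.isLt
  unfold outerStar
  omega

theorem rankIn_val_eq_of_forall (T : MNRow K t) (k : Fin K) {h : ℕ} (ht : h ≤ t)
    (h₁ : ∀ i : Fin t, i.val < h → T.1.orderEmbOfFin T.2 i < k)
    (h₂ : ∀ i : Fin t, h ≤ i.val → k ≤ T.1.orderEmbOfFin T.2 i) :
    (rankIn T k).val = h := by
  have : T.1.filter (· < k) =
      (Finset.univ.filter fun i : Fin t => i.val < h).map (T.1.orderEmbOfFin T.2).toEmbedding := by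
    ext x
    simp only [Finset.mem_filter, Finset.mem_map, Finset.mem_univ, true_and,
      RelEmbedding.coe_toEmbedding]
    constructor
    · rintro ⟨hx, hxk⟩
      obtain ⟨i, rfl⟩ : x ∈ Set.range (T.1.orderEmbOfFin T.2) := by
        rw [Finset.range_orderEmbOfFin]
        exact hx
      exact ⟨i, not_le.1 fun hi => (h₂ i hi).not_gt hxk, rfl⟩
    · rintro ⟨i, hi, rfl⟩
      exact ⟨Finset.orderEmbOfFin_mem _ _ _, h₁ i hi⟩
  change (T.1.filter (· < k)).card = h
  rw [this, Finset.card_map, Fin.card_filter_val_lt, min_eq_right ht]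

theorem exists_orderEmbOfFin_eq (T : MNRow K t) {k : Fin K} (hk : k ∈ T.1) :
    ∃ i : Fin t, T.1.orderEmbOfFin T.2 i = k ∧ (T.1.filter (· < k)).card = i.val := by
  obtain ⟨i, hi⟩ : k ∈ Set.range (T.1.orderEmbOfFin T.2) := by
    rw [Finset.range_orderEmbOfFin]
    exact hk
  refine ⟨i, hi, ?_⟩
  refine rankIn_val_eq_of_forall T k i.isLt.le (fun i' h => ?_) fun i' h => ?_
  · rw [← hi]
    exact (T.1.orderEmbOfFin T.2).strictMono h
  · rw [← hi]
    exact (T.1.orderEmbOfFin T.2).monotone h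

/-- Every vertical position lies in one of the groups of `L` consecutive positions that start at the
stars of `T`, or corresponds to a column outside `T`. -/
theorem exists_group_or_column {K₁ L : ℕ} (hL : 0 < L) (T : MNRow (K₁ - t * (L - 1)) t) {x : ℕ}
    (hx : x < K₁) :
    (∃ (i : Fin t) (l : Fin L), x = outerStar L T i + l) ∨
      ∃ k ∉ T.1, x = k.val + (rankIn T k).val * (L - 1) := by
  classical
  have hex : ∃ h, ∀ i : Fin t, h ≤ i.val → x < outerStar L T i :=
    ⟨t, fun i hi => absurd i.isLt hi.not_gt⟩
  -- $h$ is the number of stars at or before $x$.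
  set h := Nat.find hex with hh
  have habove : ∀ i : Fin t, h ≤ i.val → x < outerStar L T i := Nat.find_spec hex
  have ht : h ≤ t := Nat.find_min' hex fun i hi => absurd i.isLt hi.not_gt
  by_cases hgroup : ∃ (i : Fin t) (l : Fin L), x = outerStar L T i + l
  · exact Or.inl hgroup
  right
  -- As $x$ lies in no group, the group of star $h-1$ has ended: $T_{h-1}+(h-1)(L-1)+L\le x$. The
  -- strict inequality obtained here is what later gives $k\notin T$ for $k=x-h(L-1)$.
  have hbelow : ∀ i : Fin t, i.val < h →
      (T.1.orderEmbOfFin T.2 i).val + h * (L - 1) < x := by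
    intro i hi
    have hlast : ¬∀ i : Fin t, h - 1 ≤ i.val → x < outerStar L T i :=
      Nat.find_min hex (by omega)
    push Not at hlast
    obtain ⟨i', hi', hxi'⟩ := hlast
    have hi'h : i'.val < h := not_le.1 fun hle => (habove i' hle).not_ge hxi'
    have hge : outerStar L T i' + L ≤ x := by
      by_contra hlt
      exact hgroup ⟨i', ⟨x - outerStar L T i', by omega⟩, by simp only; omega⟩
    have hle : T.1.orderEmbOfFin T.2 i ≤ T.1.orderEmbOfFin T.2 i' :=
      (T.1.orderEmbOfFin T.2).monotone (show i.val ≤ i'.val by omega)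
    have hle' : (T.1.orderEmbOfFin T.2 i).val ≤ (T.1.orderEmbOfFin T.2 i').val := hle
    have heq : h = i'.val + 1 := by omega
    rw [heq, Nat.succ_mul]
    unfold outerStar at hge
    omega
  have hmono : ∀ i : Fin t, h ≤ i.val → x < (T.1.orderEmbOfFin T.2 i).val + i.val * (L - 1) :=
    habove
  have hxh : h * (L - 1) ≤ x := by
    rcases Nat.eq_zero_or_pos h with h0 | h0
    · simp [h0]
    · have := hbelow ⟨h - 1, by omega⟩ (by simp only; omega)
      omega
  have hfirst : ∀ i : Fin t, h ≤ i.val →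
      x < (T.1.orderEmbOfFin T.2 i).val + h * (L - 1) := by
    intro i hi
    have h1 := hmono ⟨h, hi.trans_lt i.isLt⟩ le_rfl
    have h2 : T.1.orderEmbOfFin T.2 ⟨h, hi.trans_lt i.isLt⟩ ≤ T.1.orderEmbOfFin T.2 i :=
      (T.1.orderEmbOfFin T.2).monotone hi
    have h3 : (T.1.orderEmbOfFin T.2 ⟨h, hi.trans_lt i.isLt⟩).val ≤
      (T.1.orderEmbOfFin T.2 i).val := h2
    simp only at h1
    omega
  have hk : x - h * (L - 1) < K₁ - t * (L - 1) := by
    rcases ht.lt_or_eq with hlt | heq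
    · have h1 := hfirst ⟨h, hlt⟩ le_rfl
      have h2 := (T.1.orderEmbOfFin T.2 ⟨h, hlt⟩).isLt
      omega
    · rw [heq] at hxh ⊢
      omega
  have hrank : (rankIn T ⟨x - h * (L - 1), hk⟩).val = h := by
    refine rankIn_val_eq_of_forall T _ ht (fun i hi => ?_) fun i hi => ?_
    · have := hbelow i hi
      rw [Fin.lt_def]
      simp only
      omega
    · have := hfirst i hi
      rw [Fin.le_def]
      simp only
      omega
  refine ⟨⟨x - h * (L - 1), hk⟩, fun hmem => ?_, ?_⟩
  · obtain ⟨i, hi, -⟩ := exists_orderEmbOfFin_eq T hmem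
    have hi' : (T.1.orderEmbOfFin T.2 i).val = x - h * (L - 1) := congrArg Fin.val hi
    rcases lt_or_ge i.val h with h1 | h1
    · have := hbelow i h1
      omega
    · have := hfirst i h1
      omega
  · rw [hrank]
    simp only
    omega

end Positions

/-! ### The placement delivery array property -/

section PlacementDelivery

variable {K₁ K₂ L t : ℕ}

theorem Fin.sub_val_of_val_eq_add {n : ℕ} {a c : Fin n} {l : ℕ} (h : a.val = c.val + l) :
    (a - c).val = l := by
  rw [Fin.sub_val_of_le (Fin.le_def.2 (by omega))]
  omega

theorem accesses_of_val_eq_add (hL : 0 < L) {u c : Grid K₁ K₂} {l : ℕ} (hl : l < L)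
    (h₁ : u.1.val = c.1.val + l) (h₂ : u.2 = c.2) : Accesses L u c := by
  refine ⟨by rwa [Fin.sub_val_of_val_eq_add h₁], ?_⟩
  rw [Fin.sub_val_of_val_eq_add (l := 0) (by rw [h₂, add_zero])]
  exact hL

/-- Each entry of the user-delivery array is a symbol, unless the user can access a cache-node
storing the packet of the row. -/
theorem hybridEntry_or_star (hL : 0 < L) (j : HybridRow K₁ K₂ L t) (u : Grid K₁ K₂) :
    (∃ s, HybridEntry j u s) ∨ ∃ c, HybridStar j c ∧ Accesses L u c := by
  rcases exists_group_or_column hL j.1 u.1.isLt with ⟨i, l, hu⟩ | ⟨k, hk, hu⟩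
  · by_cases h : (u.2 - j.2 i).val < L
    · right
      have := outerStar_add_le j.1 i
      refine ⟨(⟨outerStar L j.1 i, by omega⟩, j.2 i), ⟨i, rfl, rfl⟩, ?_, h⟩
      rw [Fin.sub_val_of_val_eq_add hu]
      exact l.isLt
    · exact Or.inl ⟨_, HybridEntry.typeI j u i l _ hu (if_neg h)⟩
  · exact Or.inl ⟨_, HybridEntry.typeII j u k _ hu (if_neg hk)⟩

theorem partitionPDA_eq_some {q m z : ℕ} {i : Fin m} {f : Fin m → Fin q} {k : Fin q}
    {v : (Fin m → Fin q) × Fin q} :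
    partitionPDA z i f k = some v ↔
      z ≤ (k - f i).val ∧ v = (Function.update f i k, f i - k) := by
  unfold partitionPDA
  split_ifs with h
  · simp only [false_iff, not_and]
    omega
  · simp only [Option.some.injEq, not_lt.1 h, true_and, eq_comm]

theorem mnPDA_eq_some {K t : ℕ} {T : MNRow K t} {k : Fin K} {S : Finset (Fin K)} :
    mnPDA T k = some S ↔ k ∉ T.1 ∧ S = insert k T.1 := by
  unfold mnPDA
  split_ifs with h
  · simp [h]
  · simp only [Option.some.injEq, h, not_false_eq_true, true_and, eq_comm]

/-- If $i=i'$, the symbol gives back both the column and the row. Otherwise coordinate $i$ of $f'$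
was not overwritten, so $f'_i=u_2$, and star $i$ of row $(T,f')$ lies $l$ vertical steps behind $u$
in the same horizontal position. -/
theorem eq_or_star_of_typeI (hL : 0 < L) {T : MNRow (K₁ - t * (L - 1)) t} {f f' : Fin t → Fin K₂}
    {u u' : Grid K₁ K₂} {i i' : Fin t} {l : ℕ} (hl : l < L)
    (hu : u.1.val = outerStar L T i + l) (hu' : u'.1.val = outerStar L T i' + l)
    (hf : Function.update f i u.2 = Function.update f' i' u'.2)
    (hδ : f i - u.2 = f' i' - u'.2) :
    ((T, f) = (T, f') ∧ u = u') ∨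
      ∃ c, HybridStar ((T, f') : HybridRow K₁ K₂ L t) c ∧ Accesses L u c := by
  have : NeZero K₂ := ⟨u.2.pos.ne'⟩
  by_cases h : i = i'
  · subst h
    have h1 : u.2 = u'.2 := by simpa using congrFun hf i
    rw [h1] at hf hδ
    have h2 : f i = f' i := sub_left_injective hδ
    refine Or.inl ⟨?_, Prod.ext (Fin.ext (by omega)) h1⟩
    congr 1
    funext x
    rcases eq_or_ne x i with rfl | hx
    · exact h2
    · simpa [hx] using congrFun hf x
  · right
    have h1 : u.2 = f' i := by simpa [h] using congrFun hf i
    have := outerStar_add_le T i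
    refine ⟨(⟨outerStar L T i, by omega⟩, f' i), ⟨i, rfl, rfl⟩, ?_⟩
    exact accesses_of_val_eq_add hL hl hu h1

/-- If $k\ne k'$, then $k$ is an element of $T'$, say the $i$-th. Comparing the inserted vectors at
the rank of $k$ in $T\cup\{k\}$ gives $f'_i=u_2$, so star $i$ of row $j'$ is accessible if its
vertical distance is below $L$. That distance is $0$ for $k<k'$ and $L-1$ for $k>k'$. -/
theorem eq_or_star_of_typeII (hL : 0 < L) {j j' : HybridRow K₁ K₂ L t} {u u' : Grid K₁ K₂}
    {k k' : Fin (K₁ - t * (L - 1))}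
    (hu : u.1.val = k.val + (rankIn j.1 k).val * (L - 1))
    (hu' : u'.1.val = k'.val + (rankIn j'.1 k').val * (L - 1))
    (hk : k ∉ j.1.1) (hk' : k' ∉ j'.1.1) (hS : insert k j.1.1 = insert k' j'.1.1)
    (he : Fin.insertNth (α := fun _ => Fin K₂) (rankIn j.1 k) u.2 j.2 =
      Fin.insertNth (α := fun _ => Fin K₂) (rankIn j'.1 k') u'.2 j'.2) :
    (j = j' ∧ u = u') ∨ ∃ c, HybridStar j' c ∧ Accesses L u c := by
  by_cases h : k = k'
  · subst h
    have hT : j.1 = j'.1 := by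
      apply Subtype.ext
      rw [← Finset.erase_insert hk, hS, Finset.erase_insert hk']
    rw [hT] at he hu
    obtain ⟨h1, h2⟩ := Fin.insertNth_injective2 he
    exact Or.inl ⟨Prod.ext hT h2, Prod.ext (Fin.ext (by omega)) h1⟩
  right
  have hmem : k ∈ j'.1.1 := Finset.mem_of_mem_insert_of_ne (hS ▸ Finset.mem_insert_self _ _) h
  obtain ⟨i, hi, hcard⟩ := exists_orderEmbOfFin_eq j'.1 hmem
  have hrank : (rankIn j.1 k).val = ((insert k' j'.1.1).filter (· < k)).card := by
    rw [← hS, Finset.filter_insert, if_neg (lt_irrefl _)]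
    rfl
  have hstar : ∀ n, n < L → (rankIn j.1 k).val * (L - 1) = i.val * (L - 1) + n →
      (rankIn j'.1 k').succAbove i = rankIn j.1 k →
      ∃ c, HybridStar j' c ∧ Accesses L u c := by
    intro n hn hmul hsucc
    have h2 : u.2 = j'.2 i := by
      have := congrFun he (rankIn j.1 k)
      rw [Fin.insertNth_apply_same, ← hsucc, Fin.insertNth_apply_succAbove] at this
      exact this
    have := outerStar_add_le j'.1 i
    refine ⟨(⟨outerStar L j'.1 i, by omega⟩, j'.2 i), ⟨i, rfl, rfl⟩, ?_⟩
    refine accesses_of_val_eq_add hL hn ?_ h2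
    simp only [outerStar, hi]
    omega
  rcases lt_or_gt_of_ne h with hlt | hgt
  · rw [Finset.filter_insert, if_neg hlt.not_gt, hcard] at hrank
    refine hstar 0 hL (by rw [hrank, add_zero]) ?_
    rw [Fin.succAbove_of_castSucc_lt]
    · exact Fin.ext hrank.symm
    · rw [Fin.lt_def]
      change i.val < (j'.1.1.filter (· < k')).card
      rw [← hcard]
      refine Finset.card_lt_card ⟨fun x hx => ?_, fun hsub => ?_⟩
      · rw [Finset.mem_filter] at hx ⊢
        exact ⟨hx.1, hx.2.trans hlt⟩
      · exact lt_irrefl _ (Finset.mem_filter.1 (hsub (Finset.mem_filter.2 ⟨hmem, hlt⟩))).2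
  · rw [Finset.filter_insert, if_pos hgt, Finset.card_insert_of_notMem
      (fun hx => hk' (Finset.mem_filter.1 hx).1), hcard] at hrank
    -- Here $k'$ is counted below $k$, so the rank is $i+1$ and the position moves by exactly $L-1$,
    -- the largest distance allowed.
    refine hstar (L - 1) (by omega) (by rw [hrank, Nat.succ_mul]) ?_
    rw [Fin.succAbove_of_le_castSucc]
    · exact Fin.ext hrank.symm
    · rw [Fin.le_def]
      change (j'.1.1.filter (· < k')).card ≤ i.val
      rw [← hcard]
      refine Finset.card_le_card fun x hx => ?_
      rw [Finset.mem_filter] at hx ⊢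
      exact ⟨hx.1, hx.2.trans hgt⟩

/-- If two entries of the user-delivery array carry the same symbol, then the user of the first one
can access the packet of the second one. -/
theorem HybridEntry.eq_or_star (hL : 0 < L) {j j' : HybridRow K₁ K₂ L t} {u u' : Grid K₁ K₂}
    {s : HybridSymbol K₁ K₂ L t} (h : HybridEntry j u s) (h' : HybridEntry j' u' s) :
    (j = j' ∧ u = u') ∨ ∃ c, HybridStar j' c ∧ Accesses L u c := by
  cases h with
  | typeI i l v hu hv =>
    obtain ⟨T, f⟩ := j
    obtain ⟨T', f'⟩ := j'
    generalize hs : (Sum.inl (T, l, v) : HybridSymbol K₁ K₂ L t) = s at h'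
    cases h' with
    | typeII => cases hs
    | typeI i' l' v' hu' hv' =>
      cases hs
      obtain ⟨-, hv⟩ := partitionPDA_eq_some.1 hv
      obtain ⟨-, hv'⟩ := partitionPDA_eq_some.1 hv'
      rw [hv, Prod.mk.injEq] at hv'
      exact eq_or_star_of_typeI hL l.isLt hu hu' hv'.1 hv'.2
  | typeII k S hu hS =>
    generalize hs : (Sum.inr (S, Fin.insertNth (α := fun _ => Fin K₂) (rankIn j.1 k) u.2 j.2) :
      HybridSymbol K₁ K₂ L t) = s at h'
    cases h' with
    | typeI => cases hs
    | typeII k' S' hu' hS' =>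
      obtain ⟨hSS, he⟩ := Prod.mk.inj (Sum.inr.inj hs)
      obtain ⟨hk, hS⟩ := mnPDA_eq_some.1 hS
      obtain ⟨hk', hS'⟩ := mnPDA_eq_some.1 hS'
      exact eq_or_star_of_typeII hL hu hu' hk hk' (by rw [← hS, ← hS', hSS]) he

/-- Access depends only on cyclic differences, so the first-round property transfers to every round
by translation. -/
theorem exists_accesses_of_unshift {j : HybridRow K₁ K₂ L t} {u : Grid K₁ K₂} {r : Fin K₁}
    (h : ∃ c, HybridStar j c ∧ Accesses L (unshift r u) c) :
    ∃ c, HybridStar j (unshift r c) ∧ Accesses L u c := by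
  have : NeZero K₁ := ⟨r.pos.ne'⟩
  obtain ⟨c, hc, h1, h2⟩ := h
  refine ⟨(c.1 + r, c.2), ?_, ?_, h2⟩
  · simpa [unshift] using hc
  · simpa [unshift, sub_sub, add_comm] using h1

end PlacementDelivery

/-! ### The hybrid scheme -/

section HybridProtocol

variable {K₁ K₂ L t : ℕ}

theorem hybridProtocol_decodable (hL : 0 < L) (N : ℕ) (A : Type) [AddCommGroup A] :
    (hybridProtocol K₁ K₂ L t N A).Decodable L := by
  classical
  refine Protocol.decodable_of_determined fun d u W W' hc hs => ?_
  have hcached : ∀ (n : Fin N) (r : Fin K₁) (j : HybridRow K₁ K₂ L t),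
      (∃ c, HybridStar j c ∧ Accesses L (unshift r u) c) → W n (r, j) = W' n (r, j) := by
    intro n r j h
    obtain ⟨c, hstar, hacc⟩ := exists_accesses_of_unshift h
    exact congrFun (hc c hacc) (n, ⟨(r, j), hstar⟩)
  funext p
  obtain ⟨r, j⟩ := p
  rcases hybridEntry_or_star hL j (unshift r u) with ⟨s, hjs⟩ | h
  swap
  · exact hcached _ _ _ h
  have hsum := congrFun hs (r, ⟨s, j, unshift r u, hjs⟩)
  change ∑ e : HybridRow K₁ K₂ L t × Grid K₁ K₂ with HybridEntry e.1 (unshift r e.2) s,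
      W (d e.2) (r, e.1) =
    ∑ e : HybridRow K₁ K₂ L t × Grid K₁ K₂ with HybridEntry e.1 (unshift r e.2) s,
      W' (d e.2) (r, e.1) at hsum
  have hmem : (j, u) ∈ Finset.univ.filter fun e : HybridRow K₁ K₂ L t × Grid K₁ K₂ =>
      HybridEntry e.1 (unshift r e.2) s := Finset.mem_filter.2 ⟨Finset.mem_univ _, hjs⟩
  -- Isolate the wanted packet; by the placement delivery property the remaining terms agree for
  -- both libraries and cancel.
  rw [← Finset.add_sum_erase _ _ hmem, ← Finset.add_sum_erase _ _ hmem] at hsum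
  rw [Finset.sum_congr rfl fun e he => ?_] at hsum
  · exact add_right_cancel hsum
  · obtain ⟨hne, he⟩ := Finset.mem_erase.1 he
    refine hcached _ _ _ ((hjs.eq_or_star hL (Finset.mem_filter.1 he).2).resolve_left ?_)
    rintro ⟨h1, h2⟩
    have : NeZero K₁ := ⟨r.pos.ne'⟩
    refine hne (Prod.ext h1.symm (Prod.ext ?_ ?_))
    · exact (sub_left_injective (congrArg Prod.fst h2)).symm
    · exact (congrArg Prod.snd h2).symm

theorem card_MNRow (K t : ℕ) : Nat.card (MNRow K t) = K.choose t := by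
  rw [Nat.card_eq_fintype_card, Fintype.card_finset_len, Fintype.card_fin]

theorem hybridProtocol_F (N : ℕ) (A : Type) [AddCommMonoid A] :
    (hybridProtocol K₁ K₂ L t N A).F = K₁ * ((K₁ - t * (L - 1)).choose t * K₂ ^ t) := by
  simp only [Protocol.F, hybridProtocol, Nat.card_prod, card_MNRow, Nat.card_fun, Nat.card_fin]

theorem card_subtype_apply_eq {t K : ℕ} (i : Fin t) (x : Fin K) :
    Nat.card {f : Fin t → Fin K // f i = x} = K ^ (t - 1) := by
  rw [Nat.card_eq_fintype_card, Fintype.card_subtype]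
  have := Fintype.card_filter_piFinset_const_eq_of_mem (Finset.univ : Finset (Fin K)) i
    (Finset.mem_univ x)
  simpa using this

/-- The packets stored in a cache-node correspond to the stars of the rows. -/
noncomputable def storedEquiv (hL : 0 < L) (c : Grid K₁ K₂) :
    MNRow (K₁ - t * (L - 1)) t × (Σ i : Fin t, {f : Fin t → Fin K₂ // f i = c.2}) ≃
      {p : Fin K₁ × HybridRow K₁ K₂ L t // HybridStar p.2 (unshift p.1 c)} := by
  have hlt : ∀ (T : MNRow (K₁ - t * (L - 1)) t) i, outerStar L T i < K₁ := fun T i => by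
    have := outerStar_add_le T i
    omega
  have : NeZero K₁ := ⟨c.1.pos.ne'⟩
  -- The round is forced: it is the shift carrying star $i$ of $T$ to the vertical position of $c$.
  refine Equiv.ofBijective (fun x => ⟨(c.1 - ⟨outerStar L x.1 x.2.1, hlt _ _⟩, (x.1, x.2.2.1)),
    x.2.1, ?_, x.2.2.2.symm⟩) ⟨?_, ?_⟩
  · simp [unshift]
  · rintro ⟨T, i, f, hf⟩ ⟨T', i', f', hf'⟩ h
    have h0 := congrArg Subtype.val h
    simp only [Prod.mk.injEq] at h0
    obtain ⟨h1, rfl, rfl⟩ := h0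
    have h2 := Fin.val_eq_of_eq (sub_right_injective h1)
    obtain rfl := (outerStar_strictMono L T).injective h2
    rfl
  · rintro ⟨⟨r, T, f⟩, i, h1, h2⟩
    refine ⟨(T, ⟨i, f, h2.symm⟩), Subtype.ext (Prod.ext ?_ rfl)⟩
    simp only
    have : (⟨outerStar L T i, hlt _ _⟩ : Fin K₁) = c.1 - r := Fin.ext h1.symm
    rw [this, sub_sub_cancel]

theorem hybridProtocol_cacheSize (hL : 0 < L) (N : ℕ) (A : Type)
    [AddCommMonoid A] (c : Grid K₁ K₂) :
    (hybridProtocol K₁ K₂ L t N A).cacheSize c =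
      N * ((K₁ - t * (L - 1)).choose t * (t * K₂ ^ (t - 1))) := by
  have h : (hybridProtocol K₁ K₂ L t N A).cacheSize c = Nat.card (Fin N ×
      {p : Fin K₁ × HybridRow K₁ K₂ L t // HybridStar p.2 (unshift p.1 c)}) := rfl
  rw [h, Nat.card_prod, ← Nat.card_congr (storedEquiv hL c), Nat.card_prod, card_MNRow,
    Nat.card_sigma]
  simp only [card_subtype_apply_eq, Nat.card_fin, Finset.sum_const, Finset.card_univ,
    Fintype.card_fin, smul_eq_mul]

/-- Since $\delta=f_i-k$, an entry is not a star exactly when $-\delta$ is at least $L$. Every such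
symbol already occurs in the block $i=0$, so the $t$ blocks add no new symbols; this sharing gives
the coding gain $t$. -/
theorem exists_hybridEntry_inl_iff [NeZero K₂] (h0 : 0 < t)
    {T : MNRow (K₁ - t * (L - 1)) t} {l : Fin L} {g : Fin t → Fin K₂} {δ : Fin K₂} :
    (∃ j u, HybridEntry j u (Sum.inl (T, l, (g, δ)) : HybridSymbol K₁ K₂ L t)) ↔
      L ≤ (-δ).val := by
  constructor
  · rintro ⟨j, u, h⟩
    cases h with
    | typeI i l v hu hv =>
      obtain ⟨h, heq⟩ := partitionPDA_eq_some.1 hv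
      rw [Prod.mk.injEq] at heq
      rwa [heq.2, neg_sub]
  · intro h
    have hlt := outerStar_add_le T (⟨0, h0⟩ : Fin t)
    refine ⟨(T, Function.update g ⟨0, h0⟩ (g ⟨0, h0⟩ + δ)),
      (⟨outerStar L T ⟨0, h0⟩ + l, by omega⟩, g ⟨0, h0⟩),
      HybridEntry.typeI (T, _) _ ⟨0, h0⟩ l _ rfl (partitionPDA_eq_some.2 ⟨?_, ?_⟩)⟩
    · simpa using h
    · simp

theorem exists_hybridEntry_inr_iff {S : Finset (Fin (K₁ - t * (L - 1)))} {e : Fin (t + 1) → Fin K₂} :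
    (∃ j u, HybridEntry j u (Sum.inr (S, e) : HybridSymbol K₁ K₂ L t)) ↔ S.card = t + 1 := by
  constructor
  · rintro ⟨j, u, h⟩
    generalize hs : (Sum.inr (S, e) : HybridSymbol K₁ K₂ L t) = s at h
    cases h with
    | typeI => cases hs
    | typeII k S' hu hS =>
      obtain ⟨rfl, -⟩ := Prod.mk.inj (Sum.inr.inj hs)
      obtain ⟨hk, rfl⟩ := mnPDA_eq_some.1 hS
      rw [Finset.card_insert_of_notMem hk, j.1.2]
  · intro h
    obtain ⟨k, hk⟩ : S.Nonempty := Finset.card_pos.1 (by omega)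
    -- Any $k\in S$ will do: deleting it from $S$, and the coordinate at its rank from $e$, gives a
    -- row that produces the symbol.
    let T : MNRow (K₁ - t * (L - 1)) t := ⟨S.erase k, by rw [Finset.card_erase_of_mem hk, h]; rfl⟩
    have hlt : k.val + (rankIn T k).val * (L - 1) < K₁ := by
      have h1 := k.isLt
      have h2 : (rankIn T k).val * (L - 1) ≤ t * (L - 1) :=
        Nat.mul_le_mul_right _ (Nat.le_of_lt_succ (rankIn T k).isLt)
      omega
    have key := HybridEntry.typeII (L := L) (K₂ := K₂)
      (T, (rankIn T k).removeNth (α := fun _ => Fin K₂) e) (⟨_, hlt⟩, e (rankIn T k)) k S rfl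
      (mnPDA_eq_some.2 ⟨Finset.notMem_erase _ _, (Finset.insert_erase hk).symm⟩)
    simp only [Fin.insertNth_self_removeNth] at key
    exact ⟨_, _, key⟩

theorem card_le_neg_val [NeZero K₂] (hLK : L ≤ K₂) :
    Nat.card {δ : Fin K₂ // L ≤ (-δ).val} = K₂ - L := by
  have e : {δ : Fin K₂ // L ≤ (-δ).val} ≃ {δ : Fin K₂ // ¬ δ.val < L} :=
    (Equiv.neg (Fin K₂)).subtypeEquiv fun δ => by simp
  rw [Nat.card_congr e, Nat.card_eq_fintype_card, Fintype.card_subtype_compl,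
    Fintype.card_subtype, Fin.card_filter_val_lt, Fintype.card_fin, min_eq_right hLK]

/-- The symbols occurring in the user-delivery array. -/
noncomputable def symbolEquiv [NeZero K₂] (h0 : 0 < t) :
    {s : HybridSymbol K₁ K₂ L t // ∃ j u, HybridEntry j u s} ≃
      (MNRow (K₁ - t * (L - 1)) t × Fin L × (Fin t → Fin K₂) ×
        {δ : Fin K₂ // L ≤ (-δ).val}) ⊕
      (MNRow (K₁ - t * (L - 1)) (t + 1) × (Fin (t + 1) → Fin K₂)) :=
  Equiv.subtypeSum.trans <| Equiv.sumCongr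
    { toFun := fun x => (x.1.1, x.1.2.1, x.1.2.2.1, ⟨x.1.2.2.2,
        (exists_hybridEntry_inl_iff h0).1 x.2⟩)
      invFun := fun y => ⟨(y.1, y.2.1, y.2.2.1, y.2.2.2.1),
        (exists_hybridEntry_inl_iff h0).2 y.2.2.2.2⟩
      left_inv := fun _ => rfl
      right_inv := fun _ => rfl }
    { toFun := fun x => (⟨x.1.1, exists_hybridEntry_inr_iff.1 x.2⟩, x.1.2)
      invFun := fun y => ⟨(y.1.1, y.2), exists_hybridEntry_inr_iff.2 y.1.2⟩
      left_inv := fun _ => rfl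
      right_inv := fun _ => rfl }

theorem hybridProtocol_numSent (hLK : L < K₂) (h0 : 0 < t) (N : ℕ) (A : Type)
    [AddCommMonoid A] (d : Grid K₁ K₂ → Fin N) :
    (hybridProtocol K₁ K₂ L t N A).numSent d =
      K₁ * ((K₁ - t * (L - 1)).choose t * (L * (K₂ ^ t * (K₂ - L))) +
        (K₁ - t * (L - 1)).choose (t + 1) * K₂ ^ (t + 1)) := by
  have : NeZero K₂ := ⟨by omega⟩
  have h : (hybridProtocol K₁ K₂ L t N A).numSent d = Nat.card (Fin K₁ ×
      {s : HybridSymbol K₁ K₂ L t // ∃ j u, HybridEntry j u s}) := rfl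
  rw [h, Nat.card_prod, Nat.card_congr (symbolEquiv h0), Nat.card_sum]
  simp only [Nat.card_prod, card_MNRow, card_le_neg_val hLK.le, Nat.card_fun,
    Nat.card_fin]

/-- The condition $tL\le K_1$ is equivalent to $K_1'\ge t$, so the binomial coefficient does not
vanish. -/
theorem hybridProtocol_F_pos (hL : 0 < L) (hLK : L < K₂) (h0 : 0 < t) (ht : t * L ≤ K₁) (N : ℕ)
    (A : Type) [AddCommMonoid A] : 0 < (hybridProtocol K₁ K₂ L t N A).F := by
  have h1 : 0 < t * L := Nat.mul_pos h0 hL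
  have h2 : t * (L - 1) + t = t * L := by
    rw [← Nat.mul_succ]
    congr 1
    omega
  rw [hybridProtocol_F]
  refine Nat.mul_pos (by omega) (Nat.mul_pos (Nat.choose_pos (by omega)) (pow_pos ?_ _))
  omega

theorem hybridProtocol_cacheSize_eq_mul_F (hL : 0 < L) (h0 : 0 < t) (N : ℕ) (A : Type)
    [AddCommMonoid A] (c : Grid K₁ K₂) :
    ((hybridProtocol K₁ K₂ L t N A).cacheSize c : ℝ) =
      (N : ℝ) * t / ((K₁ : ℝ) * K₂) * (hybridProtocol K₁ K₂ L t N A).F := by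
  have h1 : (0 : ℝ) < K₁ := by exact_mod_cast c.1.pos
  have h2 : (0 : ℝ) < K₂ := by exact_mod_cast c.2.pos
  rw [hybridProtocol_cacheSize hL, hybridProtocol_F]
  obtain ⟨t, rfl⟩ : ∃ n, t = n + 1 := ⟨t - 1, by omega⟩
  simp only [Nat.add_sub_cancel, pow_succ, Nat.cast_mul, Nat.cast_pow]
  field_simp

theorem hybridProtocol_numSent_eq_mul_F (hL : 0 < L) (hLK : L < K₂) (h0 : 0 < t)
    (ht : t * L ≤ K₁) (N : ℕ) (A : Type) [AddCommMonoid A] (d : Grid K₁ K₂ → Fin N) :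
    ((hybridProtocol K₁ K₂ L t N A).numSent d : ℝ) =
      hybridLoad K₁ K₂ L t * (hybridProtocol K₁ K₂ L t N A).F := by
  have h1 : t * (L - 1) + t = t * L := by
    rw [← Nat.mul_succ]
    congr 1
    omega
  -- This identity turns the ratio of consecutive binomial coefficients into $(K_1-tL)/(t+1)$, the
  -- Type II part of the load up to the factor $K_2$.
  have hsub : K₁ - t * (L - 1) - t = K₁ - t * L := by omega
  have hchoose := Nat.choose_succ_right_eq (K₁ - t * (L - 1)) t
  rw [hsub] at hchoose
  have hchoose' : ((K₁ - t * (L - 1)).choose (t + 1) : ℝ) * (t + 1) =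
      (K₁ - t * (L - 1)).choose t * (K₁ - t * L) := by
    have := congrArg (Nat.cast : ℕ → ℝ) hchoose
    push_cast [ht] at this
    exact this
  have ht0 : (0 : ℝ) < t := by exact_mod_cast h0
  have hC : ((K₁ - t * (L - 1)).choose (t + 1) : ℝ) =
      (K₁ - t * (L - 1)).choose t * (K₁ - t * L) / (t + 1) := by
    rw [← hchoose']
    field_simp
  rw [hybridProtocol_numSent hLK h0, hybridProtocol_F, hybridLoad]
  push_cast [hLK.le]
  rw [hC]
  field_simp
  ring

end HybridProtocol

/-! ### The corner points and their envelope -/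

section CornerPoints

variable {K₁ K₂ L : ℕ}

theorem cornerPoints_finite (K₁ K₂ L N : ℕ) : (cornerPoints K₁ K₂ L N).Finite := by
  refine Set.Finite.union ?_ (by simp)
  refine ((Set.finite_Icc 1 (K₁ / L)).image fun t : ℕ =>
    ((N : ℝ) * t / ((K₁ : ℝ) * K₂), hybridLoad K₁ K₂ L t)).subset ?_
  rintro p ⟨t, h1, h2, rfl⟩
  exact ⟨t, ⟨h1, h2⟩, rfl⟩

theorem exists_rat_eq_of_mem_cornerPoints {N : ℕ} {p : ℝ × ℝ} (hp : p ∈ cornerPoints K₁ K₂ L N) :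
    ∃ a : ℚ, (a : ℝ) = p.1 := by
  rcases hp with ⟨t, -, -, rfl⟩ | rfl | rfl
  · exact ⟨(N : ℚ) * t / ((K₁ : ℚ) * K₂), by push_cast; rfl⟩
  · exact ⟨0, by simp⟩
  · exact ⟨(N : ℚ) / (L : ℚ) ^ 2, by push_cast; rfl⟩

theorem achieves_of_mem_cornerPoints {N : ℕ} (hL : 0 < L) (hLK : L < K₂) (hK : K₂ ≤ K₁) {p : ℝ × ℝ}
    (hp : p ∈ cornerPoints K₁ K₂ L N) : Achieves K₁ K₂ L N p.1 p.2 := by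
  rcases hp with ⟨t, h0, ht, rfl⟩ | rfl | rfl
  · rw [Nat.le_div_iff_mul_le hL] at ht
    -- The subpacketization does not depend on the packet length; length $0$ merely names it.
    refine ⟨_, hybridProtocol_F_pos hL hLK h0 ht N (Packet 0), 0, fun b _ =>
      ⟨hybridProtocol K₁ K₂ L t N (Packet b), ?_, hybridProtocol_decodable hL N _, fun c => ?_,
        fun d => ?_⟩⟩
    · rw [hybridProtocol_F, hybridProtocol_F]
    · rw [hybridProtocol_cacheSize_eq_mul_F hL h0, hybridProtocol_F, hybridProtocol_F]
    · rw [hybridProtocol_numSent_eq_mul_F hL hLK h0 ht, hybridProtocol_F, hybridProtocol_F]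
  · exact achieves_zero_memory
  · exact achieves_zero_load hL (hLK.le.trans hK) hLK.le

end CornerPoints

theorem theorem4 (K₁ K₂ L N : ℕ) (hL : 0 < L) (hLK : L < K₂) (hK : K₂ ≤ K₁) (hN : 0 < N) :
    -- the hybrid scheme attains its corner points, whatever the length of the packets
    (∀ t : ℕ, 1 ≤ t → t ≤ K₁ / L → ∀ b : ℕ,
      0 < (hybridProtocol K₁ K₂ L t N (Packet b)).F ∧
      (hybridProtocol K₁ K₂ L t N (Packet b)).Decodable L ∧
      (∀ c, ((hybridProtocol K₁ K₂ L t N (Packet b)).cacheSize c : ℝ) =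
        (N : ℝ) * t / ((K₁ : ℝ) * K₂) * (hybridProtocol K₁ K₂ L t N (Packet b)).F) ∧
      (∀ d, ((hybridProtocol K₁ K₂ L t N (Packet b)).numSent d : ℝ) =
        hybridLoad K₁ K₂ L t * (hybridProtocol K₁ K₂ L t N (Packet b)).F)) ∧
    -- all corner points are achieved
    (∀ p ∈ cornerPoints K₁ K₂ L N, Achieves K₁ K₂ L N p.1 p.2) ∧
    -- their lower convex envelope is achieved exactly at each rational memory size
    (∀ M : ℚ, 0 ≤ (M : ℝ) → (M : ℝ) ≤ (N : ℝ) / (L : ℝ) ^ 2 →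
      Achieves K₁ K₂ L N M (lowerConvexEnvelope (cornerPoints K₁ K₂ L N) M)) ∧
    -- and up to an arbitrarily small excess load at each real memory size
    (∀ M : ℝ, 0 ≤ M → M ≤ (N : ℝ) / (L : ℝ) ^ 2 → ∀ ε : ℝ, 0 < ε →
      Achieves K₁ K₂ L N M (lowerConvexEnvelope (cornerPoints K₁ K₂ L N) M + ε)) := by
  have hl : ∀ M : ℝ, 0 ≤ M → ∃ p ∈ cornerPoints K₁ K₂ L N, p.1 ≤ M := fun M hM =>
    ⟨(0, (K₁ : ℝ) * K₂), Or.inr (Or.inl rfl), hM⟩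
  have hr : ∀ M : ℝ, M ≤ (N : ℝ) / (L : ℝ) ^ 2 → ∃ q ∈ cornerPoints K₁ K₂ L N, M ≤ q.1 :=
    fun M hM => ⟨((N : ℝ) / (L : ℝ) ^ 2, 0), Or.inr (Or.inr rfl), hM⟩
  have hA : ∀ p ∈ cornerPoints K₁ K₂ L N, Achieves K₁ K₂ L N p.1 p.2 := fun p hp =>
    achieves_of_mem_cornerPoints hL hLK hK hp
  refine ⟨fun t h0 ht b => ?_, hA, fun M hM0 hM => ?_, fun M hM0 hM ε hε => ?_⟩
  · rw [Nat.le_div_iff_mul_le hL] at ht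
    exact ⟨hybridProtocol_F_pos hL hLK h0 ht N _, hybridProtocol_decodable hL N _,
      hybridProtocol_cacheSize_eq_mul_F hL h0 N _,
      hybridProtocol_numSent_eq_mul_F hL hLK h0 ht N _⟩
  · exact achieves_lowerConvexEnvelope (cornerPoints_finite K₁ K₂ L N) hA
      (fun p hp => exists_rat_eq_of_mem_cornerPoints hp) (hl M hM0) (hr M hM)
  · exact achieves_lowerConvexEnvelope_add (cornerPoints_finite K₁ K₂ L N) hA
      (hl M hM0) (hr M hM) hε
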